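/- There is a universal constant $C>0$ such that the following holds. Let $s\ge 2$ and let $T_1,\dots,T_s$ be nondegenerate geodesic tetrahedra in hyperbolic space $\mathbb{H}^3$, whose vertices may be points of $\mathbb{H}^3$ or ideal points of $\partial\mathbb{H}^3$, with pairwise disjoint interiors. Suppose that all of them share a common edge $e$, that is, there is one geodesic $e$ that is an edge of every $T_i$. Then $$\sum_{i=1}^{s}\operatorname{Vol}(T_i)\le C\log s .$$ -/

import Mathlib

open MeasureTheory Metric

noncomputable section

namespace HyperbolicThree

/-- Euclidean three-space. Hyperbolic three-space is its open unit ball `ball 0 1` with the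
Riemannian metric `kleinMetric` (the projective, or Beltrami-Klein, model), and the unit sphere is
the sphere at infinity. In this model the geodesics are exactly the Euclidean chords of the ball. -/
abbrev E3 : Type := EuclideanSpace ℝ (Fin 3)

/-- The Beltrami-Klein metric tensor (of constant curvature `-1`) at the point `x` of the open
unit ball, applied to the tangent vectors `u` and `v`. -/
def kleinMetric (x u v : E3) : ℝ :=
  inner ℝ u v / (1 - ‖x‖ ^ 2) + inner ℝ x u * inner ℝ x v / (1 - ‖x‖ ^ 2) ^ 2

/-- The matrix of the metric tensor at `x` in the standard coordinates. -/
def kleinGram (x : E3) : Matrix (Fin 3) (Fin 3) ℝ :=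
  Matrix.of fun i j => kleinMetric x (EuclideanSpace.single i 1) (EuclideanSpace.single j 1)

/-- Hyperbolic volume: the Riemannian volume measure `√(det g) dx` on the open unit ball,
extended by zero to the rest of Euclidean space. -/
def hypVolume : Measure E3 :=
  (volume.restrict (ball 0 1)).withDensity fun x =>
    ENNReal.ofReal (Real.sqrt (kleinGram x).det)

/-- The determinant of the metric tensor: the volume density is `(1 - ‖x‖ ^ 2) ^ (-2)`. -/
theorem det_kleinGram {x : E3} (hx : x ∈ ball (0 : E3) 1) :
    (kleinGram x).det = ((1 - ‖x‖ ^ 2) ^ 4)⁻¹ := by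
  have hn : ‖x‖ < 1 := by simpa using hx
  have h : 1 - ‖x‖ ^ 2 ≠ 0 := by nlinarith [norm_nonneg x]
  have hs : ‖x‖ ^ 2 = x 0 ^ 2 + x 1 ^ 2 + x 2 ^ 2 := by
    simp [EuclideanSpace.norm_sq_eq, Fin.sum_univ_three]
  have hc : x 2 ^ 2 = ‖x‖ ^ 2 - x 0 ^ 2 - x 1 ^ 2 := by linarith
  simp only [Matrix.det_fin_three, kleinGram, kleinMetric, Matrix.of_apply]
  generalize ‖x‖ ^ 2 = r at h hs hc ⊢
  simp [EuclideanSpace.inner_single_right]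
  field_simp
  ring_nf
  rw [hc]
  ring

/-- A (nondegenerate, geodesic) tetrahedron in hyperbolic three-space: four affinely independent
vertices, each of them either a point of hyperbolic space (norm less than `1`) or an ideal point
on the sphere at infinity (norm equal to `1`). -/
structure Tetrahedron extends Affine.Simplex ℝ E3 3 where
  norm_le_one : ∀ i, ‖points i‖ ≤ 1

namespace Tetrahedron

/-- The set of points of hyperbolic space that lie in the tetrahedron: the convex hull of the
vertices, without the ideal vertices. Hyperbolic convex hulls are Euclidean ones in this model. -/
def body (T : Tetrahedron) : Set E3 :=
  convexHull ℝ (Set.range T.points) ∩ ball 0 1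

/-- The geodesic with endpoints `p` and `q` is an edge of the tetrahedron `T`, that is, `p` and `q`
are two different vertices of `T`. (An edge is determined by its two endpoints.) -/
def HasEdge (T : Tetrahedron) (p q : E3) : Prop :=
  ∃ a b : Fin 4, a ≠ b ∧ T.points a = p ∧ T.points b = q

/-- The hyperbolic volume of a tetrahedron. -/
def vol (T : Tetrahedron) : ENNReal := hypVolume T.body

end Tetrahedron

end HyperbolicThree

end

namespace HyperbolicThree

open Set Filter Topology

/-! The common edge turns volume into a weighted planar area. In homogeneous coordinates `A`, `B`,
`W` adapted to the chord through the edge, the form `1 - ‖x‖ ^ 2` becomes `A * B - ‖W‖ ^ 2` and the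
chord is `W = 0`. Each tetrahedron projects under `W` to a sector with apex `0`, and disjoint
interiors give disjoint sectors (`disjoint_sector`). The volume density has degree `-4`, so volume
can be computed on the part `‖W‖ ≤ 1` of the cone over the tetrahedron and then fibered over `w = W`
(`lintegral_le_of_fiber_le`).

The fiber over `w` lies in a quadrant `a ≥ L₁`, `b ≥ L₂`, where the density integrates to a
logarithm. With `M` the sum of the lengths of the two components of `w` along the sides of the
sector, `L₁ * L₂ ≥ M ^ 2`, so the fiber contributes at most `log (1 / g)`, `g = 1 - ‖w‖ ^ 2 / M ^
2`. This is singular only along the bounding rays, where `g` tends to `0`.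

Finally `log (1 / g) ≤ 2 * log s + 2 / (s * √g)`. The first term is integrated over disjoint parts
of the unit disc and gives `O(log s)` in total. The integral of `1 / √g` over one sector is at most
`2` whatever its angle (`lintegral_sectorWeight_le`), so `s` tetrahedra together add only `O(1)`. -/

/-! ### Elementary integrals and the logarithmic inequality -/

theorem lintegral_Ioi_of_hasDerivAt_of_nonneg {F f : ℝ → ℝ} {a l : ℝ}
    (hc : ContinuousWithinAt F (Ici a) a) (hd : ∀ x ∈ Ioi a, HasDerivAt F (f x) x)
    (hf : ∀ x ∈ Ioi a, 0 ≤ f x) (hl : Tendsto F atTop (𝓝 l)) :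
    ∫⁻ x in Ioi a, ENNReal.ofReal (f x) = ENNReal.ofReal (l - F a) := by
  rw [← integral_Ioi_of_hasDerivAt_of_nonneg hc hd hf hl,
    ofReal_integral_eq_lintegral_ofReal (integrableOn_Ioi_deriv_of_nonneg hc hd hf hl)]
  exact (ae_restrict_iff' measurableSet_Ioi).2 (ae_of_all _ hf)

theorem lintegral_Ioo_of_hasDerivAt_of_nonneg {F f : ℝ → ℝ} {a b : ℝ} (hab : a ≤ b)
    (hc : ContinuousOn F (Icc a b)) (hd : ∀ x ∈ Ioo a b, HasDerivAt F (f x) x)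
    (hf : ∀ x ∈ Ioo a b, 0 ≤ f x) :
    ∫⁻ x in Ioo a b, ENNReal.ofReal (f x) = ENNReal.ofReal (F b - F a) := by
  have hi := intervalIntegral.integrableOn_deriv_of_nonneg hc hd hf
  rw [← intervalIntegral.integral_eq_sub_of_hasDerivAt_of_le hab hc hd
      ((intervalIntegrable_iff_integrableOn_Ioc_of_le hab).2 hi),
    intervalIntegral.integral_of_le hab, integral_Ioc_eq_integral_Ioo,
    ofReal_integral_eq_lintegral_ofReal (hi.mono_set Ioo_subset_Ioc_self)]
  exact (ae_restrict_iff' measurableSet_Ioo).2 (ae_of_all _ hf)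

/-- The two-dimensional integral that gives the volume of an infinitesimally thin wedge. -/
theorem lintegral_lintegral_inv_sq {r L₁ L₂ : ℝ} (hr : 0 < r) (h₁ : 0 < L₁) (h₂ : 0 < L₂)
    (h : r < L₁ * L₂) :
    ∫⁻ a in Ioi L₁, ∫⁻ b in Ioi L₂, ENNReal.ofReal (((a * b - r) ^ 2)⁻¹) =
      ENNReal.ofReal (r⁻¹ * Real.log (L₁ * L₂ / (L₁ * L₂ - r))) := by
  have inner : ∀ a ∈ Ioi L₁, ∫⁻ b in Ioi L₂, ENNReal.ofReal (((a * b - r) ^ 2)⁻¹) =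
      ENNReal.ofReal ((a * (a * L₂ - r))⁻¹) := by
    intro a ha
    have ha' : L₁ < a := ha
    have ha0 : 0 < a := h₁.trans ha'
    have pos : ∀ b, L₂ ≤ b → 0 < a * b - r := by
      intro b hb
      have : L₁ * L₂ ≤ a * b := mul_le_mul ha'.le hb h₂.le ha0.le
      linarith
    have hd : ∀ b, L₂ ≤ b → HasDerivAt (fun b => -(a * (a * b - r))⁻¹) (((a * b - r) ^ 2)⁻¹) b := by
      intro b hb
      have hne := (pos b hb).ne'
      have := ((((hasDerivAt_id b).const_mul a).sub_const r).const_mul a).fun_inv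
        (mul_ne_zero ha0.ne' hne)
      refine this.neg.congr_deriv ?_
      simp only [id]
      field_simp
    have hl : Tendsto (fun b => -(a * (a * b - r))⁻¹) atTop (𝓝 0) := by
      have : Tendsto (fun b => a * (a * b - r)) atTop atTop :=
        (tendsto_atTop_add_const_right _ (-r) (tendsto_id.const_mul_atTop ha0)).const_mul_atTop ha0
      simpa using this.inv_tendsto_atTop.neg
    rw [lintegral_Ioi_of_hasDerivAt_of_nonneg
      (hd L₂ le_rfl).continuousAt.continuousWithinAt (fun b hb => hd b (le_of_lt hb))
      (fun b _ => by positivity) hl]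
    simp
  rw [setLIntegral_congr_fun measurableSet_Ioi inner]
  have pos : ∀ a, L₁ ≤ a → 0 < a * L₂ - r := by
    intro a ha
    have : L₁ * L₂ ≤ a * L₂ := mul_le_mul_of_nonneg_right ha h₂.le
    linarith
  -- A single logarithm of `L₂ - r / a`, not a difference of two, so that the limit at infinity is
  -- immediate.
  have hd : ∀ a, L₁ ≤ a → HasDerivAt (fun a => r⁻¹ * Real.log (L₂ - r * a⁻¹))
      ((a * (a * L₂ - r))⁻¹) a := by
    intro a ha
    have ha0 : 0 < a := h₁.trans_le ha
    have hne := (pos a ha).ne'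
    have e : L₂ - r * a⁻¹ = (a * L₂ - r) / a := by field_simp
    have hne' : L₂ - r * a⁻¹ ≠ 0 := by rw [e]; positivity
    have := ((((hasDerivAt_inv ha0.ne').const_mul r).const_sub L₂).log hne').const_mul r⁻¹
    refine this.congr_deriv ?_
    rw [e]
    field_simp
  have hl : Tendsto (fun a : ℝ => r⁻¹ * Real.log (L₂ - r * a⁻¹)) atTop (𝓝 (r⁻¹ * Real.log L₂)) := by
    refine Tendsto.const_mul _ ?_
    refine (Real.continuousAt_log h₂.ne').tendsto.comp ?_
    simpa using (tendsto_inv_atTop_zero.const_mul r).const_sub L₂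
  rw [lintegral_Ioi_of_hasDerivAt_of_nonneg
      (hd L₁ le_rfl).continuousAt.continuousWithinAt (fun a ha => hd a (le_of_lt ha))
      (fun a ha => inv_nonneg.2 (mul_nonneg (h₁.trans ha).le (pos a (le_of_lt ha)).le)) hl]
  congr 1
  have hp := pos L₁ le_rfl
  have e : L₂ - r * L₁⁻¹ = (L₁ * L₂ - r) / L₁ := by field_simp
  rw [e, ← mul_sub, ← Real.log_div h₂.ne' (by positivity)]
  congr 2
  field_simp

/-- This is `log x ≤ x - 1` at `x = 1 / (s * √g)`. It trades the logarithmic singularity for a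
constant `log s` plus an integrable singularity with the small factor `1 / s`. -/
theorem log_inv_le {g s : ℝ} (hg : 0 < g) (hs : 0 < s) :
    Real.log g⁻¹ ≤ 2 * (Real.log s + s⁻¹ * (√g)⁻¹) := by
  have h1 : 0 < √g := Real.sqrt_pos.2 hg
  have h2 : Real.log (s⁻¹ * (√g)⁻¹) ≤ s⁻¹ * (√g)⁻¹ :=
    (Real.log_le_sub_one_of_pos (by positivity)).trans (by linarith)
  have h3 : Real.log (s⁻¹ * (√g)⁻¹) = - Real.log s - Real.log g / 2 := by
    rw [Real.log_mul (by positivity) (by positivity), Real.log_inv, Real.log_inv,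
      Real.log_sqrt hg.le]
    ring
  rw [Real.log_inv]
  linarith

/-! ### The singular weight on a planar sector -/

/-- The integrand that bounds the contribution of a sector with bisector the positive real axis
and half-angle `arccos c`. -/
noncomputable def sectorWeight (c : ℝ) (w : ℂ) : ENNReal :=
  {w : ℂ | ‖w‖ ≤ 1 ∧ c * ‖w‖ < w.re}.indicator
    (fun w => ENNReal.ofReal ((√(1 - c ^ 2 * ‖w‖ ^ 2 / w.re ^ 2))⁻¹)) w

theorem measurable_sectorWeight (c : ℝ) : Measurable (sectorWeight c) := by
  unfold sectorWeight
  refine Measurable.indicator (by fun_prop) ?_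
  exact (measurableSet_le (f := fun w : ℂ => ‖w‖) (by fun_prop) measurable_const).inter
    (measurableSet_lt (f := fun w : ℂ => c * ‖w‖) (g := Complex.re) (by fun_prop) (by fun_prop))

/-- With `S = √(1 - c ^ 2)`, on a line parallel to the bisector the weight is `x / √(S ^ 2 * x ^ 2 -
c ^ 2 * y ^ 2)`, which has an explicit antiderivative vanishing at the edge of the sector. At the
unit circle the root equals `√(S ^ 2 - y ^ 2) ≤ S`. -/
theorem lintegral_sectorWeight_slice {c : ℝ} (h0 : 0 < c) (h1 : c < 1) (y : ℝ) :
    ∫⁻ x : ℝ, sectorWeight c ⟨x, y⟩ ≤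
      (Icc (-√(1 - c ^ 2)) √(1 - c ^ 2)).indicator
        (fun _ => ENNReal.ofReal ((√(1 - c ^ 2))⁻¹)) y := by
  have hS2 : 0 < 1 - c ^ 2 := by nlinarith
  set S := √(1 - c ^ 2) with hS
  have hSpos : 0 < S := Real.sqrt_pos.2 hS2
  have hSS : S ^ 2 = 1 - c ^ 2 := Real.sq_sqrt hS2.le
  have key : ∀ x, (‖(⟨x, y⟩ : ℂ)‖ ≤ 1 ∧ c * ‖(⟨x, y⟩ : ℂ)‖ < x) →
      0 < x ∧ x ^ 2 + y ^ 2 ≤ 1 ∧ c ^ 2 * y ^ 2 < S ^ 2 * x ^ 2 := by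
    rintro x ⟨ha, hb⟩
    have hn : ‖(⟨x, y⟩ : ℂ)‖ ^ 2 = x ^ 2 + y ^ 2 := by
      rw [Complex.sq_norm, Complex.normSq_mk]; ring
    have hn0 := norm_nonneg (⟨x, y⟩ : ℂ)
    have hx : 0 < x := lt_of_le_of_lt (by positivity) hb
    refine ⟨hx, by nlinarith, ?_⟩
    have : (c * ‖(⟨x, y⟩ : ℂ)‖) ^ 2 < x ^ 2 := by gcongr
    rw [mul_pow, hn] at this
    rw [hSS]; linarith
  by_cases hy : y ∈ Icc (-S) S
  · rw [indicator_of_mem hy]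
    have hyS : y ^ 2 ≤ S ^ 2 := sq_le_sq' hy.1 hy.2
    have hy1 : 0 ≤ 1 - y ^ 2 := by nlinarith
    set x₀ := c * |y| / S with hx₀
    set x₁ := √(1 - y ^ 2) with hx₁
    have hx₀0 : 0 ≤ x₀ := by positivity
    have hx₁2 : x₁ ^ 2 = 1 - y ^ 2 := Real.sq_sqrt hy1
    have hx₀2 : S ^ 2 * x₀ ^ 2 = c ^ 2 * y ^ 2 := by
      rw [hx₀, div_pow, mul_pow, sq_abs]; field_simp
    have h01 : x₀ ≤ x₁ := by
      refine Real.le_sqrt_of_sq_le ?_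
      have : S ^ 2 * x₀ ^ 2 ≤ S ^ 2 * (1 - y ^ 2) := by rw [hx₀2]; nlinarith
      exact le_of_mul_le_mul_left this (by positivity)
    have hle : ∀ x : ℝ, sectorWeight c ⟨x, y⟩ ≤ (Ioc x₀ x₁).indicator
        (fun x => ENNReal.ofReal (x * (√(S ^ 2 * x ^ 2 - c ^ 2 * y ^ 2))⁻¹)) x := by
      intro x
      by_cases hx : ‖(⟨x, y⟩ : ℂ)‖ ≤ 1 ∧ c * ‖(⟨x, y⟩ : ℂ)‖ < x
      · obtain ⟨hxp, ha, hb⟩ := key x hx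
        have hm : x ∈ Ioc x₀ x₁ := by
          refine ⟨?_, Real.le_sqrt_of_sq_le (by linarith)⟩
          have : S ^ 2 * x₀ ^ 2 < S ^ 2 * x ^ 2 := by rw [hx₀2]; exact hb
          exact lt_of_pow_lt_pow_left₀ 2 hxp.le (lt_of_mul_lt_mul_left this (by positivity))
        rw [indicator_of_mem hm, sectorWeight, indicator_of_mem (by exact hx)]
        refine le_of_eq ?_
        have hn : ‖(⟨x, y⟩ : ℂ)‖ ^ 2 = x ^ 2 + y ^ 2 := by
          rw [Complex.sq_norm, Complex.normSq_mk]; ring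
        have e : 1 - c ^ 2 * (x ^ 2 + y ^ 2) / x ^ 2 =
            (S ^ 2 * x ^ 2 - c ^ 2 * y ^ 2) / x ^ 2 := by
          rw [hSS]; field_simp; ring
        simp only [hn]
        rw [e, Real.sqrt_div' _ (by positivity), Real.sqrt_sq hxp.le, inv_div, div_eq_mul_inv]
      · rw [sectorWeight, indicator_of_notMem (by exact hx)]
        exact zero_le
    refine (lintegral_mono hle).trans ?_
    rw [lintegral_indicator measurableSet_Ioc, setLIntegral_congr Ioo_ae_eq_Ioc.symm]
    have pos : ∀ x, x₀ < x → 0 < S ^ 2 * x ^ 2 - c ^ 2 * y ^ 2 := by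
      intro x hx
      rw [← hx₀2]
      have : x₀ ^ 2 < x ^ 2 := by gcongr
      nlinarith [mul_pos hSpos hSpos]
    rw [lintegral_Ioo_of_hasDerivAt_of_nonneg
      (F := fun x => (S ^ 2)⁻¹ * √(S ^ 2 * x ^ 2 - c ^ 2 * y ^ 2)) h01 (by fun_prop)]
    · refine ENNReal.ofReal_le_ofReal ?_
      simp only [hx₀2, sub_self, Real.sqrt_zero, mul_zero, sub_zero]
      have : √(S ^ 2 * x₁ ^ 2 - c ^ 2 * y ^ 2) ≤ S := by
        rw [Real.sqrt_le_left hSpos.le, hx₁2]; nlinarith [sq_nonneg (c * y), sq_nonneg (S * y)]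
      calc (S ^ 2)⁻¹ * √(S ^ 2 * x₁ ^ 2 - c ^ 2 * y ^ 2) ≤ (S ^ 2)⁻¹ * S := by gcongr
        _ = S⁻¹ := by field_simp
    · intro x hx
      have hp := pos x hx.1
      have hs := Real.sqrt_pos.2 hp
      have h2 := ((((hasDerivAt_pow 2 x).const_mul (S ^ 2)).sub_const (c ^ 2 * y ^ 2)).sqrt
        hp.ne').const_mul (S ^ 2)⁻¹
      refine h2.congr_deriv ?_
      field_simp
      simp
    · intro x hx
      have := hx₀0.trans_lt hx.1
      positivity
  · rw [indicator_of_notMem hy]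
    refine le_of_eq (lintegral_eq_zero_of_ae_eq_zero (ae_of_all _ fun x => ?_))
    refine indicator_of_notMem (fun hx => hy ?_) _
    obtain ⟨hxp, ha, hb⟩ := key x hx
    refine abs_le.1 (abs_le_of_sq_le_sq ?_ hSpos.le)
    nlinarith

/-- The slice bound `1 / S` times the height `2 * S` of the sector: the angle cancels. This
uniformity is what allows arbitrarily thin or wide tetrahedra. -/
theorem lintegral_sectorWeight_le {c : ℝ} (h0 : 0 < c) (h1 : c < 1) :
    ∫⁻ w : ℂ, sectorWeight c w ≤ 2 := by
  have hS2 : 0 < 1 - c ^ 2 := by nlinarith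
  have hSpos : 0 < √(1 - c ^ 2) := Real.sqrt_pos.2 hS2
  rw [← Complex.volume_preserving_equiv_real_prod.symm.lintegral_comp (measurable_sectorWeight c),
    Measure.volume_eq_prod, lintegral_prod_symm']
  · refine (lintegral_mono (lintegral_sectorWeight_slice h0 h1)).trans ?_
    rw [lintegral_indicator measurableSet_Icc, setLIntegral_const, Real.volume_Icc,
      ← ENNReal.ofReal_mul (by positivity)]
    have : (√(1 - c ^ 2))⁻¹ * (√(1 - c ^ 2) - -√(1 - c ^ 2)) = 2 := by field_simp; norm_num
    rw [this]
    simp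
  · exact (measurable_sectorWeight c).comp (MeasurableEquiv.measurable _)

theorem lintegral_sectorWeight_rotate_le {c : ℝ} (h0 : 0 < c) (h1 : c < 1) {β : ℂ} (hβ : ‖β‖ = 1) :
    ∫⁻ w : ℂ, sectorWeight c (β * w) ≤ 2 := by
  have h := (rotation ⟨β, by simp [Submonoid.unitSphere, hβ]⟩).measurePreserving.lintegral_comp
    (measurable_sectorWeight c)
  exact h.trans_le (lintegral_sectorWeight_le h0 h1)

/-! ### From an affine chart to homogeneous coordinates -/

theorem lintegral_fin_succ {n : ℕ} {f : (Fin (n + 1) → ℝ) → ENNReal} (hf : Measurable f) :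
    ∫⁻ x, f x = ∫⁻ t : ℝ, ∫⁻ v : Fin n → ℝ, f (Fin.cons t v) := by
  have h := (volume_preserving_piFinSuccAbove (fun _ : Fin (n + 1) => ℝ) 0).symm
  rw [← h.lintegral_comp hf, Measure.volume_eq_prod, lintegral_prod]
  · refine lintegral_congr fun t => lintegral_congr fun v => congrArg f ?_
    simp [MeasurableEquiv.piFinSuccAbove, Fin.insertNthEquiv]
  · exact (hf.comp (MeasurableEquiv.measurable _)).aemeasurable

theorem measurable_fin_cons {n : ℕ} (t : ℝ) :
    Measurable fun v : Fin n → ℝ => (Fin.cons t v : Fin (n + 1) → ℝ) := by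
  refine measurable_pi_lambda _ (Fin.cases ?_ ?_)
  · simp
  · intro i; simpa using measurable_pi_apply i

theorem lintegral_fin_zero (f : (Fin 0 → ℝ) → ENNReal) : ∫⁻ x, f x = f ![] := by
  rw [lintegral_unique, Measure.volume_pi_eq_dirac ![], measure_univ, mul_one]
  rfl

theorem lintegral_fin_four {f : (Fin 4 → ℝ) → ENNReal} (hf : Measurable f) :
    ∫⁻ x, f x = ∫⁻ x : ℝ, ∫⁻ y : ℝ, ∫⁻ z : ℝ, ∫⁻ t : ℝ, f ![x, y, z, t] := by
  rw [lintegral_fin_succ hf]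
  refine lintegral_congr fun x => ?_
  have h1 := hf.comp (measurable_fin_cons (n := 3) x)
  refine (lintegral_fin_succ h1).trans ?_
  refine lintegral_congr fun y => ?_
  have h2 := h1.comp (measurable_fin_cons (n := 2) y)
  refine (lintegral_fin_succ h2).trans ?_
  refine lintegral_congr fun z => ?_
  have h3 := h2.comp (measurable_fin_cons (n := 1) z)
  refine (lintegral_fin_succ h3).trans ?_
  refine lintegral_congr fun t => ?_
  rw [lintegral_fin_zero]
  rfl

theorem lintegral_comp_smul_eq {n : ℕ} {r : ℝ} (hr : 0 < r) {f : (Fin n → ℝ) → ENNReal}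
    (hf : Measurable f) :
    ∫⁻ x, f x = ENNReal.ofReal (r ^ n) * ∫⁻ x, f (r • x) := by
  have h := Measure.map_addHaar_smul (volume : Measure (Fin n → ℝ)) hr.ne'
  rw [← lintegral_map hf (measurable_const_smul r), h, lintegral_smul_measure, smul_eq_mul,
    ← mul_assoc, ← ENNReal.ofReal_mul (by positivity), Module.finrank_fin_fun,
    abs_of_pos (by positivity), mul_inv_cancel₀ (by positivity), ENNReal.ofReal_one, one_mul]

/-- The points of the affine chart `X 0 = 1` that lie in `A`, as a cone in the space of homogeneous
coordinates. -/
def coneOver {n : ℕ} (A : Set (Fin n → ℝ)) : Set (Fin (n + 1) → ℝ) :=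
  {X | 0 < X 0 ∧ (X 0)⁻¹ • Fin.tail X ∈ A}

theorem measurableSet_coneOver {n : ℕ} {A : Set (Fin n → ℝ)} (hA : MeasurableSet A) :
    MeasurableSet (coneOver A) := by
  refine (measurableSet_lt measurable_const (measurable_pi_apply 0)).inter ?_
  refine hA.preimage (measurable_pi_lambda _ fun i => ?_)
  exact ((measurable_pi_apply (0 : Fin (n + 1))).inv).mul (measurable_pi_apply i.succ)

/-- A density of homogeneity degree `-4` on an affine chart of projective three-space, written as an
integral over part of a cone in the space of homogeneous coordinates. -/
theorem lintegral_eq_lintegral_coneOver {A : Set (Fin 3 → ℝ)} (hA : MeasurableSet A)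
    {ψ q : (Fin 4 → ℝ) → ℝ} (hψm : Measurable ψ) (hqm : Measurable q)
    (hψ : ∀ (t : ℝ) X, ψ (t • X) = t ^ 2 * ψ X) (hq : ∀ (t : ℝ) X, q (t • X) = t ^ 2 * q X)
    (hpos : ∀ x ∈ A, 0 < ψ (Fin.cons 1 x)) :
    ∫⁻ x in A, ENNReal.ofReal ((q (Fin.cons 1 x) ^ 2)⁻¹) =
      4 * ∫⁻ X, (coneOver A ∩ {X | ψ X ≤ 1}).indicator
        (fun X => ENNReal.ofReal (ψ X ^ 2 * (q X ^ 2)⁻¹)) X := by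
  have hc1 : Measurable fun x : Fin 3 → ℝ => (Fin.cons 1 x : Fin 4 → ℝ) :=
    measurable_fin_cons 1
  have hGm : Measurable ((coneOver A ∩ {X | ψ X ≤ 1}).indicator
        (fun X => ENNReal.ofReal (ψ X ^ 2 * (q X ^ 2)⁻¹))) :=
    Measurable.indicator (by fun_prop)
      ((measurableSet_coneOver hA).inter (measurableSet_le hψm measurable_const))
  have hcons : ∀ (t : ℝ) (x : Fin 3 → ℝ),
      (Fin.cons t (t • x) : Fin 4 → ℝ) = t • (Fin.cons 1 x : Fin 4 → ℝ) := by
    intro t x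
    funext i
    refine Fin.cases ?_ ?_ i <;> simp
  -- Substituting `v = t • x` gives the Jacobian `t ^ 3`; the factor `ψ ^ 2 / q ^ 2` has degree `0`,
  -- and the cutoff becomes `t ≤ 1 / √ψ`. Integrating `t ^ 3` up to there gives `1 / (4 * ψ ^ 2)`,
  -- which cancels `ψ ^ 2` and accounts for the constant `4`.
  have step : ∀ t : ℝ, ∫⁻ v : Fin 3 → ℝ, (coneOver A ∩ {X | ψ X ≤ 1}).indicator
        (fun X => ENNReal.ofReal (ψ X ^ 2 * (q X ^ 2)⁻¹)) (Fin.cons t v) =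
      ∫⁻ x in A, (Ioc 0 ((√(ψ (Fin.cons 1 x)))⁻¹)).indicator (fun t => ENNReal.ofReal
        (t ^ 3 * (ψ (Fin.cons 1 x) ^ 2 * (q (Fin.cons 1 x) ^ 2)⁻¹))) t := by
    intro t
    rcases le_or_gt t 0 with ht | ht
    · have h1 : ∀ v : Fin 3 → ℝ, (coneOver A ∩ {X | ψ X ≤ 1}).indicator
          (fun X => ENNReal.ofReal (ψ X ^ 2 * (q X ^ 2)⁻¹)) (Fin.cons t v) = 0 := fun v =>
        indicator_of_notMem (fun h => by simpa using h.1.1.trans_le ht) _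
      have h2 : ∀ x : Fin 3 → ℝ, (Ioc 0 ((√(ψ (Fin.cons 1 x)))⁻¹)).indicator
          (fun t => ENNReal.ofReal
            (t ^ 3 * (ψ (Fin.cons 1 x) ^ 2 * (q (Fin.cons 1 x) ^ 2)⁻¹))) t = 0 := fun x =>
        indicator_of_notMem (fun h => h.1.not_ge ht) _
      simp only [h1, h2, lintegral_zero]
    · have hct : Measurable fun x : Fin 3 → ℝ => (Fin.cons t x : Fin 4 → ℝ) :=
        measurable_fin_cons t
      refine (lintegral_comp_smul_eq ht (hGm.comp hct)).trans ?_
      rw [← lintegral_indicator hA,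
        ← lintegral_const_mul' _ _ ENNReal.ofReal_ne_top]
      refine lintegral_congr fun x => ?_
      simp only [Function.comp_apply]
      rw [hcons]
      have hmem : t • (Fin.cons 1 x : Fin 4 → ℝ) ∈ coneOver A ↔ x ∈ A := by
        have : Fin.tail (t • (Fin.cons 1 x : Fin 4 → ℝ)) = t • x := by
          funext i; simp [Fin.tail]
        simp [coneOver, ht, this, smul_smul, inv_mul_cancel₀ ht.ne']
      by_cases hx : x ∈ A
      · rw [indicator_of_mem hx]
        set p := ψ (Fin.cons 1 x) with hp
        have hp0 : 0 < p := hpos x hx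
        have hiff : t ^ 2 * p ≤ 1 ↔ t ≤ (√p)⁻¹ := by
          rw [← Real.sqrt_inv, Real.le_sqrt ht.le (by positivity), le_inv_comm₀ (by positivity) hp0,
            inv_eq_one_div, le_div_iff₀ (by positivity), mul_comm]
        by_cases hle : t ^ 2 * p ≤ 1
        · rw [indicator_of_mem (show t • (Fin.cons 1 x : Fin 4 → ℝ) ∈ coneOver A ∩ {X | ψ X ≤ 1} from
              ⟨hmem.2 hx, by simpa [hψ] using hle⟩),
            indicator_of_mem (show t ∈ Ioc 0 ((√p)⁻¹) from ⟨ht, hiff.1 hle⟩),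
            ← ENNReal.ofReal_mul (by positivity), hψ, hq]
          congr 2
          rw [← hp]
          field_simp
        · rw [indicator_of_notMem (fun h => hle (by simpa [hψ] using h.2)),
            indicator_of_notMem (fun h => hle (hiff.2 h.2)), mul_zero]
      · rw [indicator_of_notMem hx, indicator_of_notMem (fun h => hx (hmem.1 h.1)), mul_zero]
  rw [lintegral_fin_succ hGm]
  simp only [step]
  rw [lintegral_lintegral_swap]
  · rw [← lintegral_const_mul' _ _ (by simp)]
    refine setLIntegral_congr_fun hA fun x hx => ?_
    set p := ψ (Fin.cons 1 x) with hp
    have hp0 : 0 < p := hpos x hx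
    have hs : 0 < √p := Real.sqrt_pos.2 hp0
    set Q := (q (Fin.cons 1 x) ^ 2)⁻¹ with hQ
    have hQ0 : 0 ≤ Q := by positivity
    rw [lintegral_indicator measurableSet_Ioc, setLIntegral_congr Ioo_ae_eq_Ioc.symm,
      lintegral_Ioo_of_hasDerivAt_of_nonneg (F := fun t => t ^ 4 / 4 * (p ^ 2 * Q))
        (by positivity) (by fun_prop)]
    · rw [show (4 : ENNReal) = ENNReal.ofReal 4 by simp, ← ENNReal.ofReal_mul (by norm_num)]
      congr 1
      have h4 : √p ^ 4 = p ^ 2 := by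
        rw [show 4 = 2 * 2 by norm_num, pow_mul, Real.sq_sqrt hp0.le]
      rw [inv_pow, h4]
      field_simp
      ring
    · intro t _
      refine (((hasDerivAt_pow 4 t).div_const 4).mul_const (p ^ 2 * Q)).congr_deriv ?_
      simp
    · intro t ht
      have := ht.1
      positivity
  · have hS : MeasurableSet {z : ℝ × (Fin 3 → ℝ) | z.1 ∈ Ioc 0 ((√(ψ (Fin.cons 1 z.2)))⁻¹)} := by
      refine (measurableSet_lt measurable_const measurable_fst).inter
        (measurableSet_le measurable_fst ?_)
      exact ((hψm.comp (hc1.comp measurable_snd)).sqrt).inv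
    have hF : Measurable fun z : ℝ × (Fin 3 → ℝ) => ENNReal.ofReal
        (z.1 ^ 3 * (ψ (Fin.cons 1 z.2) ^ 2 * (q (Fin.cons 1 z.2) ^ 2)⁻¹)) := by
      have h1 : Measurable fun z : ℝ × (Fin 3 → ℝ) => ψ (Fin.cons 1 z.2) :=
        hψm.comp (hc1.comp measurable_snd)
      have h2 : Measurable fun z : ℝ × (Fin 3 → ℝ) => q (Fin.cons 1 z.2) :=
        hqm.comp (hc1.comp measurable_snd)
      exact ((measurable_fst.pow_const 3).mul ((h1.pow_const 2).mul (h2.pow_const 2).inv)).ennreal_ofReal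
    exact (hF.indicator hS).aemeasurable

/-! ### Coordinates adapted to a chord, and integration over fibers -/

/-- The linear change of homogeneous coordinates to a frame adapted to a chord of the unit ball
with distance `d` from the centre and half-length `k`. -/
noncomputable def chordMatrix (d k : ℝ) : Matrix (Fin 4) (Fin 4) ℝ :=
  !![d / k, 0, 1 / (2 * k), 1 / (2 * k); 1 / k, 0, d / (2 * k), d / (2 * k); 0, 1, 0, 0;
    0, 0, 1 / 2, -(1 / 2)]

theorem abs_det_chordMatrix {d k : ℝ} (hk : 0 < k) (h : d ^ 2 + k ^ 2 = 1) :
    |(chordMatrix d k).det| = 1 / 2 := by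
  have hd : d ^ 2 = 1 - k ^ 2 := by linarith
  have : (chordMatrix d k).det = -(1 / 2) := by
    simp [chordMatrix, Matrix.det_succ_row_zero, Fin.sum_univ_succ, Fin.succAbove, Matrix.submatrix]
    field_simp
    ring_nf
    rw [hd]
    ring
  rw [this]
  norm_num

theorem lintegral_comp_chordMatrix {d k : ℝ} (hk : 0 < k) (h : d ^ 2 + k ^ 2 = 1)
    {f : (Fin 4 → ℝ) → ENNReal} (hf : Measurable f) :
    2 * ∫⁻ x, f x = ∫⁻ x, f ((chordMatrix d k).mulVec x) := by
  have hdet := abs_det_chordMatrix hk h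
  have hne : (chordMatrix d k).det ≠ 0 := by
    intro h0
    rw [h0, abs_zero] at hdet
    norm_num at hdet
  have hmap := Real.map_matrix_volume_pi_eq_smul_volume_pi hne
  rw [abs_inv, hdet] at hmap
  have := lintegral_map (μ := volume) hf (LinearMap.continuous_of_finiteDimensional
    (Matrix.toLin' (chordMatrix d k))).measurable
  rw [hmap, lintegral_smul_measure] at this
  simpa using this

/-- An orthonormal frame adapted to a chord of the unit ball: the chord has direction `b 2`, its
midpoint is `d • b 0`, and its half-length is `k`. -/
structure ChordFrame where
  b : OrthonormalBasis (Fin 3) ℝ E3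
  d : ℝ
  k : ℝ
  k_pos : 0 < k
  sq_add_sq : d ^ 2 + k ^ 2 = 1

namespace ChordFrame

variable (F : ChordFrame)

/-- Together with `ChordFrame.B` and `ChordFrame.W`, homogeneous coordinates in which the form
`1 - ‖x‖ ^ 2` is `A x * B x - ‖W x‖ ^ 2` and the chord is `W x = 0`. -/
noncomputable def A (x : E3) : ℝ := (1 - F.d * F.b.repr x 0) / F.k + F.b.repr x 2

/-- See `ChordFrame.A`. -/
noncomputable def B (x : E3) : ℝ := (1 - F.d * F.b.repr x 0) / F.k - F.b.repr x 2

/-- See `ChordFrame.A`. -/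
noncomputable def W (x : E3) : ℂ := ⟨(F.b.repr x 0 - F.d) / F.k, F.b.repr x 1⟩

theorem norm_sq_eq (x : E3) :
    ‖x‖ ^ 2 = F.b.repr x 0 ^ 2 + F.b.repr x 1 ^ 2 + F.b.repr x 2 ^ 2 := by
  rw [← F.b.repr.norm_map x, EuclideanSpace.norm_sq_eq, Fin.sum_univ_three]
  simp

theorem norm_W_sq (x : E3) :
    ‖F.W x‖ ^ 2 = ((F.b.repr x 0 - F.d) / F.k) ^ 2 + F.b.repr x 1 ^ 2 := by
  rw [Complex.sq_norm, W, Complex.normSq_mk]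
  ring

theorem A_mul_B_sub (x : E3) : F.A x * F.B x - ‖F.W x‖ ^ 2 = 1 - ‖x‖ ^ 2 := by
  have hk := F.k_pos
  have h := F.sq_add_sq
  rw [F.norm_W_sq, F.norm_sq_eq, A, B]
  field_simp
  linear_combination (F.b.repr x 0 ^ 2 - 1) * h

/-- The product is nonnegative by `A_mul_B_sub`, and the sum is positive because `|d| < 1`. -/
theorem A_nonneg_B_nonneg {x : E3} (hx : ‖x‖ ≤ 1) : 0 ≤ F.A x ∧ 0 ≤ F.B x := by
  have hk := F.k_pos
  have h1 := F.A_mul_B_sub x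
  have h2 : 0 ≤ F.A x * F.B x := by nlinarith [norm_nonneg x, sq_nonneg ‖F.W x‖]
  have h3 : 0 < F.A x + F.B x := by
    have e : F.A x + F.B x = 2 * (1 - F.d * F.b.repr x 0) / F.k := by rw [A, B]; ring
    have hs := F.norm_sq_eq x
    have h0 : F.b.repr x 0 ^ 2 ≤ 1 := by
      nlinarith [norm_nonneg x, sq_nonneg (F.b.repr x 1), sq_nonneg (F.b.repr x 2)]
    have : F.d * F.b.repr x 0 < 1 := by
      nlinarith [F.sq_add_sq, sq_nonneg (F.d - F.b.repr x 0), mul_pos hk hk]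
    rw [e]
    have : 0 < 1 - F.d * F.b.repr x 0 := by linarith
    positivity
  constructor <;> by_contra! hneg <;> nlinarith

/-- The quadratic form `‖W‖ ^ 2` in homogeneous coordinates. -/
noncomputable def transverse (X : Fin 4 → ℝ) : ℝ := ((X 1 - F.d * X 0) / F.k) ^ 2 + X 2 ^ 2

/-- The part of the cone over `U` that lies over the value `w` of the coordinate `W`. -/
def fiber (U : Set E3) (w : ℂ) : Set (ℝ × ℝ) :=
  {z | ∃ x ∈ U, ∃ t : ℝ, 0 < t ∧ w = t * F.W x ∧ z.1 = t * F.A x ∧ z.2 = t * F.B x}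

/-- Fubini on the cone over `U`, cut off by the form `‖W‖ ^ 2`. This choice of cutoff confines `w`
to the unit disc, leaves the fibers over it uncut, and produces the factor `‖w‖ ^ 4`. -/
theorem lintegral_le_of_fiber_le {U : Set E3} (hU : MeasurableSet U) (hW : ∀ x ∈ U, F.W x ≠ 0)
    {Φ : ℂ → ENNReal} (hΦ : Measurable Φ)
    (h : ∀ w ≠ 0, ‖w‖ ≤ 1 → ∫⁻ a : ℝ, ∫⁻ b : ℝ, (F.fiber U w).indicator (fun z =>
      ENNReal.ofReal (‖w‖ ^ 4 * ((z.1 * z.2 - ‖w‖ ^ 2) ^ 2)⁻¹)) (a, b) ≤ Φ w) :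
    ∫⁻ x in U, ENNReal.ofReal (((1 - ‖x‖ ^ 2) ^ 2)⁻¹) ≤ 2 * ∫⁻ w, Φ w := by
  have hk := F.k_pos
  have hdk := F.sq_add_sq
  set e : E3 → (Fin 3 → ℝ) := fun x => WithLp.ofLp (F.b.repr x) with he
  have hemp : MeasurePreserving e volume volume :=
    (PiLp.volume_preserving_ofLp (Fin 3)).comp F.b.measurePreserving_repr
  set g : (Fin 3 → ℝ) → E3 := fun c => F.b.repr.symm (WithLp.toLp 2 c) with hg
  have hge : ∀ x, g (e x) = x := fun x => by simp [hg, he]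
  have heg : ∀ c, e (g c) = c := fun c => by simp [hg, he]
  have hgm : Measurable g :=
    F.b.repr.symm.continuous.measurable.comp (WithLp.measurable_toLp 2 _)
  set A' : Set (Fin 3 → ℝ) := g ⁻¹' U with hA'
  have hA'm : MeasurableSet A' := hU.preimage hgm
  set q : (Fin 4 → ℝ) → ℝ := fun X => X 0 ^ 2 - X 1 ^ 2 - X 2 ^ 2 - X 3 ^ 2 with hq
  have hψm : Measurable F.transverse := by unfold transverse; fun_prop
  have hqm : Measurable q := by fun_prop
  have hcons : ∀ (x : E3), (Fin.cons 1 (e x) : Fin 4 → ℝ) =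
      ![1, F.b.repr x 0, F.b.repr x 1, F.b.repr x 2] := by
    intro x
    funext i
    fin_cases i <;> rfl
  have h1 : ∫⁻ x in U, ENNReal.ofReal (((1 - ‖x‖ ^ 2) ^ 2)⁻¹) =
      ∫⁻ c in A', ENNReal.ofReal ((q (Fin.cons 1 c) ^ 2)⁻¹) := by
    have hUe : U = e ⁻¹' A' := by ext x; simp [hA', hge]
    rw [hUe, ← hemp.setLIntegral_comp_preimage hA'm]
    · refine lintegral_congr fun x => ?_
      rw [hcons, F.norm_sq_eq]
      simp only [hq]
      congr 3
      simp
      ring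
    · have := measurable_fin_cons (n := 3) 1
      exact ((hqm.comp this).pow_const 2).inv.ennreal_ofReal
  have hGm : Measurable ((coneOver A' ∩ {X | F.transverse X ≤ 1}).indicator
        (fun X => ENNReal.ofReal (F.transverse X ^ 2 * (q X ^ 2)⁻¹))) :=
    Measurable.indicator (by fun_prop)
      ((measurableSet_coneOver hA'm).inter (measurableSet_le hψm measurable_const))
  -- One factor `2` is absorbed by the determinant `±1 / 2` of the coordinate change.
  rw [h1, lintegral_eq_lintegral_coneOver hA'm hψm hqm, show (4 : ENNReal) = 2 * 2 by norm_num,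
    mul_assoc, lintegral_comp_chordMatrix hk hdk hGm]
  · have hMm : Measurable fun c : Fin 4 → ℝ => (chordMatrix F.d F.k).mulVec c :=
      (LinearMap.continuous_of_finiteDimensional
        (Matrix.toLin' (chordMatrix F.d F.k))).measurable
    gcongr
    refine (lintegral_fin_four (hGm.comp hMm)).trans_le ?_
    have hright : ∫⁻ w, Φ w = ∫⁻ x : ℝ, ∫⁻ y : ℝ, Φ ⟨x, y⟩ := by
      rw [← Complex.volume_preserving_equiv_real_prod.symm.lintegral_comp hΦ,
        Measure.volume_eq_prod, lintegral_prod]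
      · rfl
      · exact (hΦ.comp (MeasurableEquiv.measurable _)).aemeasurable
    rw [hright]
    refine lintegral_mono fun w₁ => lintegral_mono fun w₂ => ?_
    set w : ℂ := ⟨w₁, w₂⟩ with hw
    have hnw : ‖w‖ ^ 2 = w₁ ^ 2 + w₂ ^ 2 := by
      rw [hw, Complex.sq_norm, Complex.normSq_mk]; ring
    have hM : ∀ a b : ℝ, (chordMatrix F.d F.k).mulVec ![w₁, w₂, a, b] =
        ![F.d / F.k * w₁ + (a + b) / (2 * F.k), w₁ / F.k + F.d * (a + b) / (2 * F.k), w₂,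
          (a - b) / 2] := by
      intro a b
      funext i
      fin_cases i <;> simp [chordMatrix, Matrix.mulVec, dotProduct, Fin.sum_univ_succ] <;> ring
    have hd2 : F.d ^ 2 = 1 - F.k ^ 2 := by linarith
    have hψ : ∀ a b : ℝ, F.transverse ((chordMatrix F.d F.k).mulVec ![w₁, w₂, a, b]) =
        ‖w‖ ^ 2 := by
      intro a b
      rw [hM, hnw, transverse]
      simp
      field_simp
      have e : w₁ * 2 + F.d * (a + b) - F.d * (w₁ * F.d * 2 + (a + b)) = 2 * w₁ * F.k ^ 2 := by
        linear_combination -2 * w₁ * hdk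
      rw [e]
      ring
    have hqv : ∀ a b : ℝ, q ((chordMatrix F.d F.k).mulVec ![w₁, w₂, a, b]) =
        a * b - ‖w‖ ^ 2 := by
      intro a b
      rw [hM, hnw]
      simp [hq]
      field_simp
      linear_combination (4 * w₁ ^ 2 - (a + b) ^ 2) * hdk
    have hle : ∀ a b : ℝ, (((coneOver A' ∩ {X | F.transverse X ≤ 1}).indicator
        (fun X => ENNReal.ofReal (F.transverse X ^ 2 * (q X ^ 2)⁻¹))) ∘
        fun c : Fin 4 → ℝ => (chordMatrix F.d F.k).mulVec c) ![w₁, w₂, a, b] ≤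
        (if w ≠ 0 ∧ ‖w‖ ≤ 1 then (F.fiber U w).indicator (fun z =>
          ENNReal.ofReal (‖w‖ ^ 4 * ((z.1 * z.2 - ‖w‖ ^ 2) ^ 2)⁻¹)) (a, b) else 0) := by
      intro a b
      simp only [Function.comp_apply]
      by_cases hmem : (chordMatrix F.d F.k).mulVec ![w₁, w₂, a, b] ∈
          coneOver A' ∩ {X | F.transverse X ≤ 1}
      · rw [indicator_of_mem hmem, hψ, hqv]
        obtain ⟨⟨ht, hx⟩, hw1⟩ := hmem
        set X := (chordMatrix F.d F.k).mulVec ![w₁, w₂, a, b] with hX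
        have hw1' : ‖w‖ ≤ 1 := by
          have : ‖w‖ ^ 2 ≤ 1 := by rw [← hψ a b]; exact hw1
          nlinarith [norm_nonneg w]
        set x := g ((X 0)⁻¹ • Fin.tail X) with hx'
        have hr : ∀ i, F.b.repr x i = (X 0)⁻¹ * X i.succ := fun i => by
          have := congrFun (heg ((X 0)⁻¹ • Fin.tail X)) i
          exact this
        have ht' : X 0 ≠ 0 := ht.ne'
        have hr0 : F.b.repr x 0 = (X 0)⁻¹ * X 1 := hr 0
        have hr1 : F.b.repr x 1 = (X 0)⁻¹ * X 2 := hr 1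
        have hr2 : F.b.repr x 2 = (X 0)⁻¹ * X 3 := hr 2
        have hX0 : X 0 = F.d / F.k * w₁ + (a + b) / (2 * F.k) := by rw [hX, hM]; rfl
        have hX1 : X 1 = w₁ / F.k + F.d * (a + b) / (2 * F.k) := by rw [hX, hM]; rfl
        have hX2 : X 2 = w₂ := by rw [hX, hM]; rfl
        have hX3 : X 3 = (a - b) / 2 := by rw [hX, hM]; rfl
        have hxW : w = (X 0 : ℝ) * F.W x := by
          have e1 : X 0 * ((F.b.repr x 0 - F.d) / F.k) = w₁ := by
            have : X 0 * ((F.b.repr x 0 - F.d) / F.k) = (X 1 - F.d * X 0) / F.k := by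
              rw [hr0]; field_simp
            rw [this, hX0, hX1]
            field_simp
            ring_nf
            rw [hd2]
            ring
          have e2 : X 0 * F.b.repr x 1 = w₂ := by
            rw [hr1, hX2]; field_simp
          apply Complex.ext <;> simp [W, e1, e2, hw]
        have e0 : (X 0 - F.d * X 1) / F.k = (a + b) / 2 := by
          rw [hX0, hX1]
          field_simp
          ring_nf
          rw [hd2]
          ring
        have hw0 : w ≠ 0 := by
          rw [hxW]
          exact mul_ne_zero (by exact_mod_cast ht') (hW x hx)
        rw [if_pos ⟨hw0, hw1'⟩, indicator_of_mem]
        · rw [← pow_mul]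
        · refine ⟨x, hx, X 0, ht, hxW, ?_, ?_⟩
          · have : X 0 * F.A x = (X 0 - F.d * X 1) / F.k + X 3 := by
              rw [A, hr0, hr2]; field_simp
            rw [this, e0, hX3]; ring
          · have : X 0 * F.B x = (X 0 - F.d * X 1) / F.k - X 3 := by
              rw [B, hr0, hr2]; field_simp
            rw [this, e0, hX3]; ring
      · rw [indicator_of_notMem hmem]
        exact zero_le
    refine (lintegral_mono fun a => lintegral_mono fun b => hle a b).trans ?_
    by_cases hcond : w ≠ 0 ∧ ‖w‖ ≤ 1
    · simp only [if_pos hcond]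
      exact h w hcond.1 hcond.2
    · simp only [if_neg hcond, lintegral_zero]
      exact zero_le
  · intro t X
    simp only [transverse, Pi.smul_apply, smul_eq_mul]
    ring
  · intro t X
    simp only [hq, Pi.smul_apply, smul_eq_mul]
    ring
  · intro c hc
    rw [← heg c, hcons]
    have : 0 < ‖F.W (g c)‖ ^ 2 := by
      have := norm_pos_iff.2 (hW (g c) hc)
      positivity
    rw [F.norm_W_sq] at this
    simpa [transverse] using this

end ChordFrame

/-! ### Sectors and the bound for a single tetrahedron -/

/-- The open tetrahedron with vertices `p`, `q`, `u`, `v`. -/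
def openTetrahedron (p q u v : E3) : Set E3 :=
  {x | ∃ t₀ t₁ t₂ t₃ : ℝ, 0 < t₀ ∧ 0 < t₁ ∧ 0 < t₂ ∧ 0 < t₃ ∧ t₀ + t₁ + t₂ + t₃ = 1 ∧
    x = t₀ • p + t₁ • q + t₂ • u + t₃ • v}

/-- The open planar sector spanned by `u` and `v`. -/
def sector (u v : ℂ) : Set ℂ :=
  {w | ∃ s t : ℝ, 0 < s ∧ 0 < t ∧ w = s * u + t * v}

theorem measurableSet_sector {u v : ℂ} (h : LinearIndependent ℝ ![u, v]) :
    MeasurableSet (sector u v) := by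
  have e : sector u v = (fun z : ℝ × ℝ => (z.1 * u + z.2 * v : ℂ)) '' (Ioi 0 ×ˢ Ioi 0) := by
    ext w
    constructor
    · rintro ⟨s, t, hs, ht, rfl⟩
      exact ⟨(s, t), ⟨hs, ht⟩, rfl⟩
    · rintro ⟨⟨s, t⟩, ⟨hs, ht⟩, rfl⟩
      exact ⟨s, t, hs, ht, rfl⟩
  rw [e]
  refine (measurableSet_Ioi.prod measurableSet_Ioi).image_of_continuousOn_injOn
    (by fun_prop) (Function.Injective.injOn ?_)
  rintro ⟨s, t⟩ ⟨s', t'⟩ hst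
  have := LinearIndependent.pair_iff.1 h (s - s') (t - t') (by
    simp only [Complex.real_smul, Complex.ofReal_sub]
    linear_combination hst)
  ext <;> simp <;> linarith [this.1, this.2]

/-- A sector has a bisector: after a rotation by `β`, the function `s + t` on the sector spanned
by two unit vectors is proportional to the real part. -/
theorem exists_bisector {u v : ℂ} (h : LinearIndependent ℝ ![u, v]) :
    ∃ (c : ℝ) (β : ℂ), 0 < c ∧ c < 1 ∧ ‖β‖ = 1 ∧ ∀ s t : ℝ, 0 < s → 0 < t →
      (β * (s * u + t * v)).re = c * (s * ‖u‖ + t * ‖v‖) ∧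
        ‖(s * u + t * v : ℂ)‖ < s * ‖u‖ + t * ‖v‖ := by
  have hp := LinearIndependent.pair_iff.1 h
  have hu : u ≠ 0 := h.ne_zero 0
  have hv : v ≠ 0 := h.ne_zero 1
  have hu' : 0 < ‖u‖ := norm_pos_iff.2 hu
  have hv' : 0 < ‖v‖ := norm_pos_iff.2 hv
  have strict : ∀ s t : ℝ, 0 < s → 0 < t → ‖(s * u + t * v : ℂ)‖ < s * ‖u‖ + t * ‖v‖ := by
    intro s t hs ht
    have hray : ¬ SameRay ℝ ((s : ℂ) * u) (t * v) := by
      intro hr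
      obtain ⟨r₁, r₂, h1, h2, h3⟩ := hr.exists_pos
        (mul_ne_zero (by exact_mod_cast hs.ne') hu) (mul_ne_zero (by exact_mod_cast ht.ne') hv)
      have := hp (r₁ * s) (-(r₂ * t)) (by
        simp only [Complex.real_smul] at h3 ⊢
        push_cast
        linear_combination h3)
      have : 0 < r₁ * s := by positivity
      linarith
    have := norm_add_lt_of_not_sameRay hray
    simpa [abs_of_pos hs, abs_of_pos ht] using this
  -- The sum of the two unit vectors points along the bisector. Its inner product with either one is
  -- `‖σ‖ ^ 2 / 2`, whence `c = ‖σ‖ / 2`; independence gives `0 < ‖σ‖ < 2`.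
  set σ : ℂ := u / ‖u‖ + v / ‖v‖ with hσ
  have hσe : σ = ((‖u‖⁻¹ : ℝ) : ℂ) * u + ((‖v‖⁻¹ : ℝ) : ℂ) * v := by
    rw [hσ]; push_cast; ring
  have hσ0 : σ ≠ 0 := by
    intro h0
    have := hp ‖u‖⁻¹ ‖v‖⁻¹ (by simp only [Complex.real_smul]; rw [← hσe, h0])
    have : 0 < ‖u‖⁻¹ := by positivity
    linarith
  have hσp : 0 < ‖σ‖ := norm_pos_iff.2 hσ0
  have hσlt : ‖σ‖ < 2 := by
    rw [hσe]
    refine (strict _ _ (by positivity) (by positivity)).trans_eq ?_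
    field_simp
    norm_num
  have unit_re : ∀ a b : ℂ, ‖a‖ = 1 → ‖b‖ = 1 →
      ((starRingEnd ℂ) (a + b) * a).re = ‖a + b‖ ^ 2 / 2 := by
    intro a b ha hb
    have ha2 : a.re ^ 2 + a.im ^ 2 = 1 := by
      have := Complex.sq_norm a
      rw [ha, Complex.normSq_apply] at this
      linarith
    have hb2 : b.re ^ 2 + b.im ^ 2 = 1 := by
      have := Complex.sq_norm b
      rw [hb, Complex.normSq_apply] at this
      linarith
    rw [Complex.sq_norm, Complex.normSq_apply]
    simp
    linear_combination ha2 / 2 - hb2 / 2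
  have hnu : ‖u / (‖u‖ : ℂ)‖ = 1 := by simp [hu]
  have hnv : ‖v / (‖v‖ : ℂ)‖ = 1 := by simp [hv]
  have h1 := unit_re _ _ hnu hnv
  have h2 := unit_re _ _ hnv hnu
  rw [add_comm (v / (‖v‖ : ℂ))] at h2
  rw [← hσ] at h1 h2
  refine ⟨‖σ‖ / 2, (starRingEnd ℂ) σ / ‖σ‖, by positivity, by linarith, ?_, fun s t hs ht =>
    ⟨?_, strict s t hs ht⟩⟩
  · simp [hσ0]
  · have hu0 : (‖u‖ : ℂ) ≠ 0 := by exact_mod_cast hu'.ne'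
    have hv0 : (‖v‖ : ℂ) ≠ 0 := by exact_mod_cast hv'.ne'
    have e : (starRingEnd ℂ) σ / ‖σ‖ * (s * u + t * v) =
        ((s * ‖u‖ / ‖σ‖ : ℝ) : ℂ) * ((starRingEnd ℂ) σ * (u / ‖u‖)) +
        ((t * ‖v‖ / ‖σ‖ : ℝ) : ℂ) * ((starRingEnd ℂ) σ * (v / ‖v‖)) := by
      push_cast
      field_simp
    rw [e, Complex.add_re, Complex.re_ofReal_mul, Complex.re_ofReal_mul, h1, h2]
    field_simp

/-- The cross terms are compared by the arithmetic-geometric mean inequality for `a * b'` and `a' *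
b`. Applied to two vertices in the closed ball, it gives `M ^ 2 ≤ L₁ * L₂`. -/
theorem sq_add_le_mul_add {s t x y a b a' b' : ℝ} (hs : 0 ≤ s) (ht : 0 ≤ t) (hx : 0 ≤ x)
    (hy : 0 ≤ y) (ha : 0 ≤ a) (hb : 0 ≤ b) (ha' : 0 ≤ a') (hb' : 0 ≤ b') (h : x ^ 2 ≤ a * b)
    (h' : y ^ 2 ≤ a' * b') :
    (s * x + t * y) ^ 2 ≤ (s * a + t * a') * (s * b + t * b') := by
  have hcross : 2 * (x * y) ≤ a * b' + a' * b := by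
    have hsq : (2 * (x * y)) ^ 2 ≤ (a * b' + a' * b) ^ 2 := by
      have := mul_le_mul h h' (by positivity) (by positivity)
      nlinarith [sq_nonneg (a * b' - a' * b)]
    exact (sq_le_sq₀ (by positivity) (by positivity)).1 hsq
  have i1 := mul_le_mul_of_nonneg_left hcross (mul_nonneg hs ht)
  have i2 := mul_le_mul_of_nonneg_left h (mul_nonneg hs hs)
  have i3 := mul_le_mul_of_nonneg_left h' (mul_nonneg ht ht)
  linarith

theorem lintegral_fiber_le {S : Set (ℝ × ℝ)} {L₁ L₂ r : ℝ} (hS : S ⊆ Ici L₁ ×ˢ Ici L₂)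
    (h₁ : 0 < L₁) (h₂ : 0 < L₂) (hr : 0 < r) (h : r ^ 2 < L₁ * L₂) :
    ∫⁻ a : ℝ, ∫⁻ b : ℝ, S.indicator (fun z =>
        ENNReal.ofReal (r ^ 4 * ((z.1 * z.2 - r ^ 2) ^ 2)⁻¹)) (a, b) ≤
      ENNReal.ofReal (r ^ 4) * ENNReal.ofReal
        ((r ^ 2)⁻¹ * Real.log (L₁ * L₂ / (L₁ * L₂ - r ^ 2))) := by
  rw [← lintegral_lintegral_inv_sq (by positivity) h₁ h₂ h,
    ← lintegral_const_mul' _ _ ENNReal.ofReal_ne_top, setLIntegral_congr Ioi_ae_eq_Ici,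
    ← lintegral_indicator measurableSet_Ici]
  refine lintegral_mono fun a => ?_
  by_cases ha : a ∈ Ici L₁
  · rw [indicator_of_mem ha, ← lintegral_const_mul' _ _ ENNReal.ofReal_ne_top,
      setLIntegral_congr Ioi_ae_eq_Ici, ← lintegral_indicator measurableSet_Ici]
    refine lintegral_mono fun b => ?_
    by_cases hb : (a, b) ∈ S
    · rw [indicator_of_mem hb, indicator_of_mem (hS hb).2, ENNReal.ofReal_mul (by positivity)]
    · rw [indicator_of_notMem hb]
      exact zero_le
  · have : ∀ b, (a, b) ∉ S := fun b hb => ha (hS hb).1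
    simp [this]

theorem mul_log_le {r M L c s : ℝ} (hr : 0 < r) (hr1 : r ≤ 1) (hM : r < M) (hL : M ^ 2 ≤ L)
    (hs : 1 ≤ s) (hc : c = 1 - r ^ 2 / M ^ 2) :
    r ^ 4 * ((r ^ 2)⁻¹ * Real.log (L / (L - r ^ 2))) ≤ 2 * Real.log s + 2 * s⁻¹ * (√c)⁻¹ := by
  have hs0 : 0 < s := by linarith
  have hlog : 0 ≤ Real.log s := Real.log_nonneg hs
  have hM0 : 0 < M := hr.trans hM
  have hrM : r ^ 2 < M ^ 2 := by gcongr
  have hL0 : 0 < L := lt_of_lt_of_le (by positivity) hL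
  have hg0 : 0 < c := by
    rw [hc, sub_pos, div_lt_one (by positivity)]; exact hrM
  have hlogle : Real.log (L / (L - r ^ 2)) ≤ 2 * (Real.log s + s⁻¹ * (√c)⁻¹) := by
    -- `L / (L - r ^ 2)` decreases in `L`, so it is at most its value `1 / c` at `L = M ^ 2`.
    refine le_trans (Real.log_le_log ?_ ?_) (log_inv_le hg0 hs0)
    · exact div_pos hL0 (by linarith)
    · rw [div_le_iff₀ (by linarith), inv_mul_eq_div, le_div_iff₀ hg0, hc]
      have : r ^ 2 ≤ L * (r ^ 2 / M ^ 2) := by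
        rw [mul_div_assoc', le_div_iff₀ (by positivity), mul_comm]
        gcongr
      linarith
  have e : r ^ 4 * ((r ^ 2)⁻¹ * Real.log (L / (L - r ^ 2))) = r ^ 2 * Real.log (L / (L - r ^ 2)) := by
    field_simp
  have hr2 : r ^ 2 ≤ 1 := pow_le_one₀ hr.le hr1
  calc _ = _ := e
    _ ≤ r ^ 2 * (2 * (Real.log s + s⁻¹ * (√c)⁻¹)) := by gcongr
    _ ≤ 1 * (2 * (Real.log s + s⁻¹ * (√c)⁻¹)) := by gcongr
    _ = _ := by ring

namespace ChordFrame

variable (F : ChordFrame)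

theorem A_combination (p q u v : E3) {t₀ t₁ t₂ t₃ : ℝ} (h : t₀ + t₁ + t₂ + t₃ = 1) :
    F.A (t₀ • p + t₁ • q + t₂ • u + t₃ • v) =
      t₀ * F.A p + t₁ * F.A q + t₂ * F.A u + t₃ * F.A v := by
  have hk := F.k_pos.ne'
  simp only [A, map_add, map_smul, PiLp.add_apply, PiLp.smul_apply, smul_eq_mul]
  field_simp
  linear_combination -h

theorem B_combination (p q u v : E3) {t₀ t₁ t₂ t₃ : ℝ} (h : t₀ + t₁ + t₂ + t₃ = 1) :
    F.B (t₀ • p + t₁ • q + t₂ • u + t₃ • v) =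
      t₀ * F.B p + t₁ * F.B q + t₂ * F.B u + t₃ * F.B v := by
  have hk := F.k_pos.ne'
  simp only [B, map_add, map_smul, PiLp.add_apply, PiLp.smul_apply, smul_eq_mul]
  field_simp
  linear_combination -h

theorem W_combination (p q u v : E3) {t₀ t₁ t₂ t₃ : ℝ} (h : t₀ + t₁ + t₂ + t₃ = 1) :
    F.W (t₀ • p + t₁ • q + t₂ • u + t₃ • v) =
      t₀ * F.W p + t₁ * F.W q + t₂ * F.W u + t₃ * F.W v := by
  have hk := F.k_pos.ne'
  apply Complex.ext
  · simp only [W, map_add, map_smul, PiLp.add_apply, PiLp.smul_apply, smul_eq_mul,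
      Complex.add_re, Complex.re_ofReal_mul]
    field_simp
    linear_combination F.d * h
  · simp [W]

/-- The bound for the contribution of a single tetrahedron, in terms of a parameter `s`. -/
theorem lintegral_openTetrahedron_le {p q u v : E3} (hp : ‖p‖ ≤ 1) (hq : ‖q‖ ≤ 1) (hu : ‖u‖ ≤ 1)
    (hv : ‖v‖ ≤ 1) (hWp : F.W p = 0) (hWq : F.W q = 0)
    (hind : LinearIndependent ℝ ![F.W u, F.W v])
    (hm : MeasurableSet (openTetrahedron p q u v)) {s : ℝ} (hs : 1 ≤ s) :
    ∫⁻ x in openTetrahedron p q u v, ENNReal.ofReal (((1 - ‖x‖ ^ 2) ^ 2)⁻¹) ≤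
      2 * (ENNReal.ofReal (2 * Real.log s) * volume (sector (F.W u) (F.W v) ∩ closedBall 0 1) +
        ENNReal.ofReal (4 * s⁻¹)) := by
  have hs0 : 0 < s := by linarith
  have hlog : 0 ≤ Real.log s := Real.log_nonneg hs
  obtain ⟨c, β, hc0, hc1, hβ, hsec⟩ := exists_bisector hind
  have hSm := (measurableSet_sector hind).inter (isClosed_closedBall (x := (0 : ℂ)) (ε := 1)).measurableSet
  have hwm : Measurable fun w : ℂ => sectorWeight c (β * w) :=
    (measurable_sectorWeight c).comp (measurable_const_mul β)
  -- The vertices `p`, `q` contribute nothing to `W` and nonnegative amounts to `A` and `B`, which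
  -- are dropped.
  have hWx : ∀ x ∈ openTetrahedron p q u v, ∃ s t : ℝ, 0 < s ∧ 0 < t ∧
      F.W x = s * F.W u + t * F.W v ∧ s * F.A u + t * F.A v ≤ F.A x ∧
      s * F.B u + t * F.B v ≤ F.B x := by
    rintro x ⟨t₀, t₁, t₂, t₃, h0, h1, h2, h3, hsum, rfl⟩
    obtain ⟨ap, bp⟩ := F.A_nonneg_B_nonneg hp
    obtain ⟨aq, bq⟩ := F.A_nonneg_B_nonneg hq
    refine ⟨t₂, t₃, h2, h3, ?_, ?_, ?_⟩
    · rw [F.W_combination _ _ _ _ hsum, hWp, hWq]; ring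
    · rw [F.A_combination _ _ _ _ hsum]
      linarith [mul_nonneg h0.le ap, mul_nonneg h1.le aq]
    · rw [F.B_combination _ _ _ _ hsum]
      linarith [mul_nonneg h0.le bp, mul_nonneg h1.le bq]
  set Φ : ℂ → ENNReal := fun w =>
    (sector (F.W u) (F.W v) ∩ closedBall 0 1).indicator
      (fun _ => ENNReal.ofReal (2 * Real.log s)) w +
      ENNReal.ofReal (2 * s⁻¹) * sectorWeight c (β * w) with hΦ
  have hΦm : Measurable Φ := (measurable_const.indicator hSm).add (hwm.const_mul _)
  have hΦi : ∫⁻ w, Φ w ≤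
      ENNReal.ofReal (2 * Real.log s) * volume (sector (F.W u) (F.W v) ∩ closedBall 0 1) +
        ENNReal.ofReal (4 * s⁻¹) := by
    rw [hΦ, lintegral_add_left (measurable_const.indicator hSm), lintegral_indicator hSm,
      setLIntegral_const, lintegral_const_mul _ hwm]
    gcongr
    calc ENNReal.ofReal (2 * s⁻¹) * ∫⁻ w : ℂ, sectorWeight c (β * w)
        ≤ ENNReal.ofReal (2 * s⁻¹) * ENNReal.ofReal 2 := by
          gcongr
          simpa using lintegral_sectorWeight_rotate_le hc0 hc1 hβ
      _ = ENNReal.ofReal (4 * s⁻¹) := by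
          rw [← ENNReal.ofReal_mul (by positivity)]
          congr 1
          ring
  refine (F.lintegral_le_of_fiber_le hm ?_ hΦm ?_).trans (by gcongr)
  · intro x hx h0
    obtain ⟨a, b, ha, hb, hw, -⟩ := hWx x hx
    have := LinearIndependent.pair_iff.1 hind a b (by
      simp only [Complex.real_smul]
      rw [← hw, h0])
    exact ha.ne' this.1
  · intro w hw0 hw1
    by_cases hwS : w ∈ sector (F.W u) (F.W v)
    · obtain ⟨s₂, s₃, h2, h3, hw⟩ := hwS
      obtain ⟨hre, hlt⟩ := hsec s₂ s₃ h2 h3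
      rw [← hw] at hre hlt
      obtain ⟨au, bu⟩ := F.A_nonneg_B_nonneg hu
      obtain ⟨av, bv⟩ := F.A_nonneg_B_nonneg hv
      have habu : ‖F.W u‖ ^ 2 ≤ F.A u * F.B u := by
        have := F.A_mul_B_sub u
        nlinarith [norm_nonneg u]
      have habv : ‖F.W v‖ ^ 2 ≤ F.A v * F.B v := by
        have := F.A_mul_B_sub v
        nlinarith [norm_nonneg v]
      set L₁ := s₂ * F.A u + s₃ * F.A v with hL₁
      set L₂ := s₂ * F.B u + s₃ * F.B v with hL₂
      set M := s₂ * ‖F.W u‖ + s₃ * ‖F.W v‖ with hM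
      have hr0 : 0 < ‖w‖ := norm_pos_iff.2 hw0
      have hM0 : 0 < M := hr0.trans hlt
      have hML : M ^ 2 ≤ L₁ * L₂ :=
        sq_add_le_mul_add h2.le h3.le (norm_nonneg _) (norm_nonneg _) au bu av bv habu habv
      have hLL : 0 < L₁ * L₂ := lt_of_lt_of_le (by positivity) hML
      have hL₁0 : 0 ≤ L₁ := by positivity
      have hL₂0 : 0 ≤ L₂ := by positivity
      have hL₁p : 0 < L₁ := lt_of_le_of_ne hL₁0 (by rintro h; simp [← h] at hLL)
      have hL₂p : 0 < L₂ := lt_of_le_of_ne hL₂0 (by rintro h; simp [← h] at hLL)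
      have hrM : ‖w‖ ^ 2 < M ^ 2 := by gcongr
      have hrL : ‖w‖ ^ 2 < L₁ * L₂ := hrM.trans_le hML
      -- By independence of `F.W u` and `F.W v`, every point of the cone over `w` has the same
      -- coefficients `s₂`, `s₃` on `u` and `v`.
      have hsub : F.fiber (openTetrahedron p q u v) w ⊆ Ici L₁ ×ˢ Ici L₂ := by
        rintro ⟨a, b⟩ ⟨x, hx, t, ht, hwx, ha, hb⟩
        obtain ⟨τ₂, τ₃, k2, k3, hWx', hA, hB⟩ := hWx x hx
        have hlin := LinearIndependent.pair_iff.1 hind (t * τ₂ - s₂) (t * τ₃ - s₃) (by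
          simp only [Complex.real_smul]
          push_cast
          rw [hWx'] at hwx
          linear_combination hw - hwx)
        have e2 : s₂ = t * τ₂ := by linarith [hlin.1]
        have e3 : s₃ = t * τ₃ := by linarith [hlin.2]
        simp only at ha hb
        constructor
        · change L₁ ≤ a
          rw [hL₁, ha, e2, e3]
          linarith [mul_le_mul_of_nonneg_left hA ht.le]
        · change L₂ ≤ b
          rw [hL₂, hb, e2, e3]
          linarith [mul_le_mul_of_nonneg_left hB ht.le]
      have hbound := lintegral_fiber_le hsub hL₁p hL₂p hr0 hrL
      refine hbound.trans ?_
      set g := 1 - c ^ 2 * ‖β * w‖ ^ 2 / (β * w).re ^ 2 with hg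
      have hnβ : ‖β * w‖ = ‖w‖ := by rw [norm_mul, hβ, one_mul]
      have hgM : g = 1 - ‖w‖ ^ 2 / M ^ 2 := by
        rw [hg, hnβ, hre]; field_simp
      have hwt : sectorWeight c (β * w) = ENNReal.ofReal ((√g)⁻¹) := by
        rw [sectorWeight, indicator_of_mem]
        refine ⟨by rw [hnβ]; exact hw1, ?_⟩
        rw [hnβ, hre]
        gcongr
      have hmem : w ∈ sector (F.W u) (F.W v) ∩ closedBall 0 1 :=
        ⟨⟨s₂, s₃, h2, h3, hw⟩, by simpa using hw1⟩
      rw [hΦ]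
      simp only
      rw [indicator_of_mem hmem, hwt, ← ENNReal.ofReal_mul (by positivity),
        ← ENNReal.ofReal_mul (by positivity),
        ← ENNReal.ofReal_add (by positivity) (by positivity)]
      refine ENNReal.ofReal_le_ofReal ?_
      exact mul_log_le hr0 hw1 hlt hML hs hgM
    · have hempty : F.fiber (openTetrahedron p q u v) w = ∅ := by
        refine eq_empty_of_forall_notMem ?_
        rintro z ⟨x, hx, t, ht, hwx, -⟩
        obtain ⟨τ₂, τ₃, k2, k3, hWx', -⟩ := hWx x hx
        refine hwS ⟨t * τ₂, t * τ₃, by positivity, by positivity, ?_⟩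
        rw [hwx, hWx']
        push_cast
        ring
      simp [hempty]

end ChordFrame

/-! ### The frame of an edge, and projection along it -/

theorem exists_orthonormalBasis_two_eq {e : E3} (he : ‖e‖ = 1) {m : E3} (hm : inner ℝ m e = 0) :
    ∃ (b : OrthonormalBasis (Fin 3) ℝ E3) (d : ℝ), b 2 = e ∧ m = d • b 0 := by
  by_cases hm0 : m = 0
  · obtain ⟨b, hb⟩ := Orthonormal.exists_orthonormalBasis_extension_of_card_eq (𝕜 := ℝ) (E := E3)
      (ι := Fin 3) (by simp) (v := fun _ => e) (s := {2}) (by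
        constructor
        · rintro ⟨i, rfl⟩; simpa using he
        · rintro ⟨i, rfl⟩ ⟨j, rfl⟩ h; exact absurd rfl h)
    exact ⟨b, 0, hb 2 rfl, by simp [hm0]⟩
  · have hmn : ‖m‖ ≠ 0 := norm_ne_zero_iff.2 hm0
    obtain ⟨b, hb⟩ := Orthonormal.exists_orthonormalBasis_extension_of_card_eq (𝕜 := ℝ) (E := E3)
      (ι := Fin 3) (by simp) (v := ![‖m‖⁻¹ • m, 0, e]) (s := {0, 2}) (by
        constructor
        · rintro ⟨i, hi⟩
          rcases hi with rfl | rfl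
          · simp [norm_smul, hmn]
          · simpa using he
        · rintro ⟨i, hi⟩ ⟨j, hj⟩ h
          rcases hi with rfl | rfl <;> rcases hj with rfl | rfl
          · exact absurd rfl h
          · simp [inner_smul_left, hm]
          · have hm' : inner ℝ e m = 0 := (real_inner_comm m e).trans hm
            simp [inner_smul_right, hm']
          · exact absurd rfl h)
    refine ⟨b, ‖m‖, ?_, ?_⟩
    · simpa using hb 2 (by simp)
    · rw [hb 0 (by simp)]
      simp [smul_smul, hmn]

theorem exists_chordFrame {p q : E3} (hpq : p ≠ q) (hp : ‖p‖ ≤ 1) (hq : ‖q‖ ≤ 1) :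
    ∃ F : ChordFrame, F.W p = 0 ∧ F.W q = 0 ∧ F.b.repr p 2 ≠ F.b.repr q 2 := by
  have hn : 0 < ‖q - p‖ := norm_pos_iff.2 (sub_ne_zero.2 hpq.symm)
  set e : E3 := ‖q - p‖⁻¹ • (q - p) with he
  have hen : ‖e‖ = 1 := by simp [he, norm_smul, hn.ne']
  have hee : inner ℝ e e = 1 := by rw [real_inner_self_eq_norm_sq, hen]; norm_num
  -- The foot of the perpendicular from the centre, which is the midpoint of the full chord even
  -- when `p` and `q` are interior points.
  set m : E3 := p - (inner ℝ p e : ℝ) • e with hm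
  have hme : inner ℝ m e = 0 := by
    rw [hm, inner_sub_left, inner_smul_left, hee]; simp
  obtain ⟨b, d, hb, hmb⟩ := exists_orthonormalBasis_two_eq hen hme
  have hpe : p = d • b 0 + (inner ℝ p e : ℝ) • b 2 := by
    rw [← hmb, hb, hm]; simp
  have hqe : q = d • b 0 + (inner ℝ p e + ‖q - p‖ : ℝ) • b 2 := by
    have : q = p + ‖q - p‖ • b 2 := by
      rw [hb, he, smul_smul, mul_inv_cancel₀ hn.ne', one_smul]; simp
    rw [add_smul, ← add_assoc, ← hpe]
    exact this
  set z := (inner ℝ p e : ℝ) with hz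
  have repr_eq : ∀ t : ℝ, (b.repr (d • b 0 + t • b 2) 0 = d ∧ b.repr (d • b 0 + t • b 2) 1 = 0) ∧
      b.repr (d • b 0 + t • b 2) 2 = t := by
    intro t
    simp
  have norm_eq : ∀ t : ℝ, ‖d • b 0 + t • b 2‖ ^ 2 = d ^ 2 + t ^ 2 := by
    intro t
    rw [← b.repr.norm_map, EuclideanSpace.norm_sq_eq, Fin.sum_univ_three, (repr_eq t).1.1,
      (repr_eq t).1.2, (repr_eq t).2]
    simp
  -- The line meets the closed ball in two distinct points, so it is not tangent to the sphere.
  have hd : d ^ 2 < 1 := by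
    have h1 : d ^ 2 + z ^ 2 ≤ 1 := by rw [← norm_eq, ← hpe]; exact pow_le_one₀ (norm_nonneg _) hp
    have h2 : d ^ 2 + (z + ‖q - p‖) ^ 2 ≤ 1 := by
      rw [← norm_eq, ← hqe]; exact pow_le_one₀ (norm_nonneg _) hq
    by_contra! hcon
    have hz0 : z = 0 := by nlinarith
    rw [hz0] at h2
    nlinarith
  refine ⟨⟨b, d, √(1 - d ^ 2), Real.sqrt_pos.2 (by linarith), ?_⟩, ?_, ?_, ?_⟩
  · rw [Real.sq_sqrt (by linarith)]; ring
  · rw [hpe]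
    simp only [ChordFrame.W, repr_eq]
    apply Complex.ext <;> simp
  · rw [hqe]
    simp only [ChordFrame.W, repr_eq]
    apply Complex.ext <;> simp
  · rw [hpe, hqe]
    simp only [repr_eq]
    intro h
    linarith

namespace ChordFrame

variable (F : ChordFrame)

/-- If `W` vanishes at `p ≠ q`, it vanishes exactly on the line through `p` and `q`. -/
theorem exists_smul_of_W_sub_eq {p q : E3} (hp : F.W p = 0) (hq : F.W q = 0)
    (hpq : F.b.repr p 2 ≠ F.b.repr q 2) {y : E3} (hy : F.W (p + y) = 0) :
    ∃ c : ℝ, y = c • (q - p) := by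
  have hk := F.k_pos.ne'
  have zero : ∀ x, F.W x = 0 → F.b.repr x 0 = F.d ∧ F.b.repr x 1 = 0 := by
    intro x hx
    have h0 := congrArg Complex.re hx
    have h1 := congrArg Complex.im hx
    simp only [W, Complex.zero_re, Complex.zero_im, div_eq_zero_iff, hk, or_false] at h0 h1
    exact ⟨by linarith, h1⟩
  obtain ⟨p0, p1⟩ := zero p hp
  obtain ⟨q0, q1⟩ := zero q hq
  obtain ⟨y0, y1⟩ := zero _ hy
  have hne : F.b.repr q 2 - F.b.repr p 2 ≠ 0 := sub_ne_zero.2 hpq.symm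
  simp only [map_add, PiLp.add_apply, p0, p1] at y0 y1
  refine ⟨F.b.repr y 2 / (F.b.repr q 2 - F.b.repr p 2), ?_⟩
  apply F.b.repr.injective
  ext i
  simp only [map_smul, map_sub, PiLp.smul_apply, PiLp.sub_apply, smul_eq_mul]
  fin_cases i
  · simp only [Fin.zero_eta, p0, q0]; linarith
  · simp only [Fin.mk_one, p1, q1]; linarith
  · simp only [Fin.reduceFinMk]; field_simp

theorem W_add_combination {p u v : E3} (hp : F.W p = 0) (s t : ℝ) :
    F.W (p + (s • (u - p) + t • (v - p))) = s * F.W u + t * F.W v := by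
  have h := F.W_combination p p u v (t₀ := 1 - s - t) (t₁ := 0) (t₂ := s) (t₃ := t) (by ring)
  rw [hp] at h
  rw [show p + (s • (u - p) + t • (v - p)) = (1 - s - t) • p + (0 : ℝ) • p + s • u + t • v by module,
    h]
  simp

/-- A linear relation between the projections lifts to a vector parallel to the edge, hence to an
affine relation among the four vertices. -/
theorem linearIndependent_W {p q u v : E3} (hp : F.W p = 0) (hq : F.W q = 0)
    (hpq : F.b.repr p 2 ≠ F.b.repr q 2) (h : AffineIndependent ℝ ![p, q, u, v]) :
    LinearIndependent ℝ ![F.W u, F.W v] := by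
  rw [LinearIndependent.pair_iff]
  intro s t hst
  simp only [Complex.real_smul] at hst
  obtain ⟨c, hc⟩ := F.exists_smul_of_W_sub_eq hp hq hpq
    (y := s • (u - p) + t • (v - p)) (by rw [F.W_add_combination hp, hst])
  have := affineIndependent_iff.1 h Finset.univ ![c - s - t, -c, s, t]
    (by simp [Fin.sum_univ_four]; ring)
    (by
      simp only [Fin.sum_univ_four, Matrix.cons_val]
      have e : (c - s - t) • p + -c • q + s • u + t • v =
        s • (u - p) + t • (v - p) - c • (q - p) := by module
      rw [e, hc, sub_self])
  exact ⟨this 2 (Finset.mem_univ _), this 3 (Finset.mem_univ _)⟩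

/-- Tetrahedra with a common edge whose sectors meet have common interior points. -/
theorem disjoint_sector {p q u v u' v' : E3} (hp : F.W p = 0) (hq : F.W q = 0)
    (hpq : F.b.repr p 2 ≠ F.b.repr q 2)
    (h : Disjoint (openTetrahedron p q u v) (openTetrahedron p q u' v')) :
    Disjoint (sector (F.W u) (F.W v)) (sector (F.W u') (F.W v')) := by
  rw [Set.disjoint_left]
  rintro w ⟨s, t, hs, ht, hw⟩ ⟨s', t', hs', ht', hw'⟩
  set y := (s • (u - p) + t • (v - p)) with hy
  set y' := (s' • (u' - p) + t' • (v' - p)) with hy'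
  have hyy : F.W (p + (y - y')) = 0 := by
    have hsub : F.W (p + (y - y')) = F.W (p + y) - F.W (p + y') + F.W p := by
      apply Complex.ext <;> simp [W] <;> ring
    rw [hsub, hy, hy', F.W_add_combination hp, F.W_add_combination hp, ← hw, ← hw', hp]
    simp
  obtain ⟨c, hc⟩ := F.exists_smul_of_W_sub_eq hp hq hpq hyy
  -- All perturbations together stay below `1 / 4`, so that the weights `1 / 2` of the edge midpoint
  -- remain positive.
  set ε := (4 * (1 + |c| + s + t + s' + t'))⁻¹ with hε
  have hpos : 0 < 1 + |c| + s + t + s' + t' := by positivity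
  have hε0 : 0 < ε := by positivity
  have hε1 : ε * (1 + |c| + s + t + s' + t') = 1 / 4 := by rw [hε]; field_simp
  have c1 : ε * c ≤ ε * |c| := mul_le_mul_of_nonneg_left (le_abs_self c) hε0.le
  have c2 : -(ε * |c|) ≤ ε * c := by
    have := mul_le_mul_of_nonneg_left (neg_abs_le c) hε0.le
    linarith
  have e1 : 0 < ε * s := by positivity
  have e2 : 0 < ε * t := by positivity
  have e3 : 0 < ε * s' := by positivity
  have e4 : 0 < ε * t' := by positivity
  have e5 : 0 ≤ ε * |c| := by positivity
  have hε2 : ε + ε * |c| + ε * s + ε * t + ε * s' + ε * t' = 1 / 4 := by rw [← hε1]; ring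
  -- A common point is found near the midpoint of the edge; the lifts `y` and `y'` differ by `c • (q
  -- - p)`, which only shifts weight between `p` and `q`.
  have hmem : p + (1 / 2 : ℝ) • (q - p) + ε • y ∈ openTetrahedron p q u v ∧
      p + (1 / 2 : ℝ) • (q - p) + ε • y ∈ openTetrahedron p q u' v' := by
    refine ⟨?_, ?_⟩
    · refine ⟨1 / 2 - ε * s - ε * t, 1 / 2, ε * s, ε * t, by linarith, by norm_num, e1, e2, by ring, ?_⟩
      rw [hy]
      module
    · refine ⟨1 / 2 - ε * c - ε * s' - ε * t', 1 / 2 + ε * c, ε * s', ε * t', by linarith,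
        by linarith, e3, e4, by ring, ?_⟩
      have : y = y' + c • (q - p) := by rw [← hc]; abel
      rw [this, hy']
      module
  exact Set.disjoint_left.1 h hmem.1 hmem.2

end ChordFrame

/-! ### Interiors and volumes of tetrahedra -/

theorem interior_convexHull_eq_openTetrahedron {p q u v : E3}
    (h : AffineIndependent ℝ ![p, q, u, v]) :
    interior (convexHull ℝ (range ![p, q, u, v])) = openTetrahedron p q u v := by
  have htop : affineSpan ℝ (range ![p, q, u, v]) = ⊤ :=
    h.affineSpan_eq_top_iff_card_eq_finrank_add_one.2 (by simp)
  let b : AffineBasis (Fin 4) ℝ E3 := ⟨![p, q, u, v], h, htop⟩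
  have hb : ⇑b = ![p, q, u, v] := rfl
  rw [← hb, b.interior_convexHull]
  ext x
  constructor
  · intro hx
    refine ⟨b.coord 0 x, b.coord 1 x, b.coord 2 x, b.coord 3 x, hx 0, hx 1, hx 2, hx 3, ?_, ?_⟩
    · rw [← b.sum_coord_apply_eq_one x, Fin.sum_univ_four]
    · conv_lhs => rw [← b.linear_combination_coord_eq_self x, Fin.sum_univ_four]
      rfl
  · rintro ⟨t₀, t₁, t₂, t₃, h0, h1, h2, h3, hsum, rfl⟩ i
    have hw : ∑ i, (![t₀, t₁, t₂, t₃] : Fin 4 → ℝ) i = 1 := by simpa [Fin.sum_univ_four] using hsum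
    have hc := b.coord_apply_combination_of_mem (Finset.mem_univ i) hw
    rw [Finset.affineCombination_eq_linear_combination _ _ _ hw, Fin.sum_univ_four] at hc
    have : b.coord i (t₀ • p + t₁ • q + t₂ • u + t₃ • v) = (![t₀, t₁, t₂, t₃] : Fin 4 → ℝ) i := hc
    rw [this]
    fin_cases i <;> simpa

theorem interior_subset_ball {S : Set E3} (h : S ⊆ closedBall 0 1) : interior S ⊆ ball 0 1 := by
  rw [← interior_closedBall (0 : E3) one_ne_zero]
  exact interior_mono h

namespace Tetrahedron

theorem convexHull_subset (T : Tetrahedron) :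
    convexHull ℝ (range T.points) ⊆ closedBall 0 1 := by
  refine convexHull_min ?_ (convex_closedBall 0 1)
  rintro _ ⟨i, rfl⟩
  simpa using T.norm_le_one i

theorem exists_points_of_hasEdge {T : Tetrahedron} {p q : E3} (h : T.HasEdge p q) :
    ∃ u v : E3, ‖u‖ ≤ 1 ∧ ‖v‖ ≤ 1 ∧ AffineIndependent ℝ ![p, q, u, v] ∧
      range T.points = range ![p, q, u, v] := by
  obtain ⟨a, b, hab, rfl, rfl⟩ := h
  obtain ⟨σ, h0, h1⟩ : ∃ σ : Equiv.Perm (Fin 4), σ 0 = a ∧ σ 1 = b := by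
    revert a b
    decide
  have e : ![T.points a, T.points b, T.points (σ 2), T.points (σ 3)] = T.points ∘ σ := by
    funext i
    fin_cases i <;> simp [h0, h1]
  refine ⟨T.points (σ 2), T.points (σ 3), T.norm_le_one _, T.norm_le_one _, ?_, ?_⟩
  · rw [e]
    exact T.independent.comp_embedding σ.toEmbedding
  · rw [e, σ.surjective.range_comp]

theorem interior_body (T : Tetrahedron) :
    interior T.body = interior (convexHull ℝ (range T.points)) := by
  rw [body, interior_inter, isOpen_ball.interior_eq]
  exact inter_eq_left.2 (interior_subset_ball T.convexHull_subset)

/-- The frontier of a convex set is Lebesgue-null, hence null for the hyperbolic volume, and the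
interior lies in the open ball, where the density is explicit. -/
theorem vol_le (T : Tetrahedron) :
    T.vol ≤ ∫⁻ x in interior (convexHull ℝ (range T.points)),
      ENNReal.ofReal (((1 - ‖x‖ ^ 2) ^ 2)⁻¹) := by
  set S := convexHull ℝ (range T.points) with hS
  have hac : hypVolume ≪ volume :=
    (withDensity_absolutelyContinuous _ _).trans
      (Measure.absolutelyContinuous_of_le Measure.restrict_le_self)
  have hnull : hypVolume (frontier S) = 0 :=
    hac ((convex_convexHull ℝ _).addHaar_frontier volume)
  have hsub : T.body ⊆ interior S ∪ frontier S := by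
    rw [← closure_eq_interior_union_frontier]
    exact inter_subset_left.trans subset_closure
  have hball := interior_subset_ball T.convexHull_subset
  calc T.vol ≤ hypVolume (interior S) + hypVolume (frontier S) :=
        (measure_mono hsub).trans (measure_union_le _ _)
    _ = hypVolume (interior S) := by rw [hnull, add_zero]
    _ = ∫⁻ x in interior S, ENNReal.ofReal (Real.sqrt (kleinGram x).det) := by
        rw [hypVolume, withDensity_apply _ isOpen_interior.measurableSet,
          Measure.restrict_restrict isOpen_interior.measurableSet, inter_eq_left.2 hball]
    _ ≤ _ := by
        refine le_of_eq (setLIntegral_congr_fun isOpen_interior.measurableSet fun x hx => ?_)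
        have hx1 : ‖x‖ < 1 := by simpa using hball hx
        rw [det_kleinGram (hball hx), Real.sqrt_inv,
          show (1 - ‖x‖ ^ 2) ^ 4 = ((1 - ‖x‖ ^ 2) ^ 2) ^ 2 by ring, Real.sqrt_sq (by positivity)]

end Tetrahedron

end HyperbolicThree

/-! ### Summation over the tetrahedra -/

open HyperbolicThree in
theorem sum_vol_le_of_common_edge (s : ℕ) (hs : 2 ≤ s) (T : Fin s → Tetrahedron) (p q : E3)
    (hedge : ∀ i, (T i).HasEdge p q)
    (hdisj : ∀ i j, i ≠ j → Disjoint (interior (T i).body) (interior (T j).body)) :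
    ∑ i, (T i).vol ≤ ENNReal.ofReal (32 * Real.log s) := by
  obtain ⟨hpq, hp, hq⟩ : p ≠ q ∧ ‖p‖ ≤ 1 ∧ ‖q‖ ≤ 1 := by
    obtain ⟨a, b, hab, rfl, rfl⟩ := hedge ⟨0, by omega⟩
    exact ⟨fun h => hab ((T _).independent.injective h), (T _).norm_le_one _, (T _).norm_le_one _⟩
  obtain ⟨F, hFp, hFq, hF⟩ := exists_chordFrame hpq hp hq
  choose u v hu hv hind hrange using fun i => Tetrahedron.exists_points_of_hasEdge (hedge i)
  have hint : ∀ i, interior (convexHull ℝ (Set.range (T i).points)) =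
      openTetrahedron p q (u i) (v i) := fun i => by
    rw [hrange i, interior_convexHull_eq_openTetrahedron (hind i)]
  have hlin : ∀ i, LinearIndependent ℝ ![F.W (u i), F.W (v i)] := fun i =>
    F.linearIndependent_W hFp hFq hF (hind i)
  set D : Fin s → Set ℂ := fun i => sector (F.W (u i)) (F.W (v i)) ∩ closedBall 0 1 with hD
  have hDdisj : Pairwise (Function.onFun Disjoint D) := by
    intro i j hij
    have h := hdisj i j hij
    rw [Tetrahedron.interior_body, Tetrahedron.interior_body, hint, hint] at h
    exact (F.disjoint_sector hFp hFq hF h).mono Set.inter_subset_left Set.inter_subset_left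
  have hDm : ∀ i, MeasurableSet (D i) := fun i =>
    (measurableSet_sector (hlin i)).inter isClosed_closedBall.measurableSet
  -- The truncated sectors are disjoint in the unit disc, whose area is `π ≤ 4`.
  have hDvol : ∑ i, volume (D i) ≤ ENNReal.ofReal 4 := by
    rw [← tsum_fintype (L := .unconditional _), ← measure_iUnion hDdisj hDm]
    refine (measure_mono (Set.iUnion_subset fun i => Set.inter_subset_right)).trans ?_
    rw [Complex.volume_closedBall]
    simp only [ENNReal.ofReal_one, one_pow, one_mul]
    rw [← ENNReal.ofReal_coe_nnreal]
    exact ENNReal.ofReal_le_ofReal Real.pi_le_four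
  have hs2 : (2 : ℝ) ≤ s := by exact_mod_cast hs
  have hs0 : (0 : ℝ) < s := by linarith
  have hlog0 : 0 ≤ Real.log s := Real.log_nonneg (by linarith)
  -- The total will be `16 * log s + 8`; this absorbs the `8` and yields the constant `32`.
  have hlog : 1 / 2 ≤ Real.log s := by
    have := Real.log_two_gt_d9
    have := Real.log_le_log (by norm_num) hs2
    linarith
  have hvol : ∀ i, (T i).vol ≤
      2 * (ENNReal.ofReal (2 * Real.log s) * volume (D i) + ENNReal.ofReal (4 * (s : ℝ)⁻¹)) := by
    intro i
    refine (T i).vol_le.trans ?_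
    have hm : MeasurableSet (openTetrahedron p q (u i) (v i)) := by
      rw [← hint i]; exact isOpen_interior.measurableSet
    rw [hint i]
    -- The free parameter is taken to be the number of tetrahedra, so the error terms `4 / s` sum to
    -- `4`.
    exact F.lintegral_openTetrahedron_le hp hq (hu i) (hv i) hFp hFq (hlin i) hm (by linarith)
  calc ∑ i, (T i).vol ≤ ∑ i, 2 * (ENNReal.ofReal (2 * Real.log s) * volume (D i) +
        ENNReal.ofReal (4 * (s : ℝ)⁻¹)) := Finset.sum_le_sum fun i _ => hvol i
    _ = 2 * (ENNReal.ofReal (2 * Real.log s) * ∑ i, volume (D i) +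
        s * ENNReal.ofReal (4 * (s : ℝ)⁻¹)) := by
        rw [← Finset.mul_sum, Finset.sum_add_distrib, ← Finset.mul_sum]
        simp
    _ ≤ 2 * (ENNReal.ofReal (2 * Real.log s) * ENNReal.ofReal 4 +
        ENNReal.ofReal s * ENNReal.ofReal (4 * (s : ℝ)⁻¹)) := by
        rw [ENNReal.ofReal_natCast]
        gcongr
    _ = ENNReal.ofReal (2 * (2 * Real.log s * 4 + s * (4 * (s : ℝ)⁻¹))) := by
        rw [← ENNReal.ofReal_mul (by positivity), ← ENNReal.ofReal_mul (by positivity),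
          ← ENNReal.ofReal_add (by positivity) (by positivity),
          ENNReal.ofReal_mul (p := 2) (by norm_num)]
        simp
    _ ≤ ENNReal.ofReal (32 * Real.log s) := by
        refine ENNReal.ofReal_le_ofReal ?_
        have : (s : ℝ) * (4 * (s : ℝ)⁻¹) = 4 := by field_simp
        linarith

/-- The sum of the volumes of `s ≥ 2` hyperbolic tetrahedra (possibly with ideal vertices) with
pairwise disjoint interiors and a common edge is at most a universal constant times `log s`. -/
theorem proposition3p3 :
    ∃ C : ℝ, 0 < C ∧
      ∀ (s : ℕ) (_ : 2 ≤ s) (T : Fin s → HyperbolicThree.Tetrahedron) (p q : HyperbolicThree.E3),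
        (∀ i, (T i).HasEdge p q) →
        (∀ i j, i ≠ j → Disjoint (interior (T i).body) (interior (T j).body)) →
        ∑ i, (T i).vol ≤ ENNReal.ofReal (C * Real.log s) :=
  ⟨32, by norm_num, sum_vol_le_of_common_edge⟩
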